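/- Let $\mathcal H=(V,E)$ be a hypergraph, that is, a set $V$ of vertices together with a family of hyperedges indexed by a set $E$, where each $e\in E$ has a vertex set $\epsilon(e)\subseteq V$ (repeated or empty hyperedges, and vertices contained in no hyperedge, are allowed; $V$ and $E$ may be infinite). The upper closure $\Delta(\mathcal H)$ is the abstract simplicial complex whose simplices are the nonempty finite subsets of the sets $\epsilon(e)$, $e\in E$. The dual hypergraph $\mathcal H^*$ has vertex set $E$ and a hyperedge for each $v\in V$, whose vertex set is $\{e\in E : v\in\epsilon(e)\}$. For a simplicial complex $K$, a commutative ring $R$ and $p\ge 0$, let $H_p(K;R)=\ker\partial_p/\operatorname{im}\partial_{p+1}$ be the (unreduced) simplicial homology: with respect to a total order on the vertices, the $p$-chains are the finite formal $R$-linear combinations of the $p$-simplices $[x_0,\dots,x_p]$, $x_0<\dots<x_p$, with $\partial_p[x_0,\dots,x_p]=\sum_{j=0}^{p}(-1)^j[x_0,\dots,\widehat{x_j},\dots,x_p]$ for $p\ge 1$ and $\partial_0=0$. Then the closure homology of $\mathcal H$ is isomorphic to the closure homology of its dual: for every commutative ring $R$ (in particular for every field, such as $\mathbb Z/2\mathbb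 Z$), all total orders on $V$ and $E$, and every $p\ge 0$, there is an isomorphism of $R$-modules $$H_p(\Delta(\mathcal H);R)\;\cong\;H_p(\Delta(\mathcal H^*);R).$$ -/

import Mathlib

universe u v w

/-- A hypergraph with vertex set `V` and an indexed family of hyperedges `E`: every `e : E` has a
set of vertices `H.edge e`. Repeated and empty hyperedges, and vertices that lie in no hyperedge,
are allowed. -/
@[ext]
structure IndexedHypergraph (V : Type u) (E : Type v) where
  /-- the set of vertices of a hyperedge -/
  edge : E → Set V

namespace IndexedHypergraph

variable {V : Type u} {E : Type v}

/-- The dual hypergraph: vertices and hyperedges exchange roles, and the hyperedge of the dual that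
is given by `v : V` consists of all `e : E` with `v ∈ e`. -/
def dual (H : IndexedHypergraph V E) : IndexedHypergraph E V where
  edge v := {e | v ∈ H.edge e}

/-- The upper closure: the simplices are the (nonempty, finite) subsets of the hyperedges. A vertex
that lies in no hyperedge is not a simplex. -/
def upperClosure (H : IndexedHypergraph V E) : PreAbstractSimplicialComplex V where
  faces := {s | s.Nonempty ∧ ∃ e, (s : Set V) ⊆ H.edge e}
  isRelLowerSet_faces := fun _ ⟨hs, e, he⟩ =>
    ⟨hs, fun _ hts ht => ⟨ht, e, (Finset.coe_subset.2 hts).trans he⟩⟩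

end IndexedHypergraph

namespace PreAbstractSimplicialComplex

variable {V : Type u}

/-- The `p`-simplices of `K`: the simplices with `p + 1` vertices. -/
def Simplex (K : PreAbstractSimplicialComplex V) (p : ℕ) : Type u :=
  {s : Finset V // s ∈ K.faces ∧ s.card = p + 1}

/-- The `p`-chains of `K` with coefficients in `R`. -/
abbrev Chain (R : Type w) [CommRing R] (K : PreAbstractSimplicialComplex V) (p : ℕ) :
    Type (max u w) :=
  K.Simplex p →₀ R

noncomputable instance (R : Type w) [CommRing R] (K : PreAbstractSimplicialComplex V) (p : ℕ) :
    AddCommGroup (K.Chain R p) :=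
  Finsupp.instAddCommGroup

variable [LinearOrder V]

/-- The face of a `(p + 1)`-simplex opposite to its vertex `x`. -/
def Simplex.face {K : PreAbstractSimplicialComplex V} {p : ℕ} (σ : K.Simplex (p + 1))
    (x : {x // x ∈ σ.1}) : K.Simplex p :=
  ⟨σ.1.erase x.1,
    (K.isRelLowerSet_faces σ.2.1).2 (Finset.erase_subset _ _)
      (Finset.card_pos.1 (by rw [Finset.card_erase_of_mem x.2, σ.2.2]; omega)),
    by rw [Finset.card_erase_of_mem x.2, σ.2.2]; rfl⟩

/-- The boundary map from `(p + 1)`-chains to `p`-chains. Every simplex `[x₀, …, x_{p + 1}]` is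
oriented by `x₀ < ⋯ < x_{p + 1}`; its boundary is the sum of the faces
`[x₀, …, x_{j - 1}, x_{j + 1}, …, x_{p + 1}]` with the signs `(-1) ^ j`, where `j` is the number of
vertices that precede the omitted one. -/
noncomputable def boundary (R : Type w) [CommRing R] (K : PreAbstractSimplicialComplex V) (p : ℕ) :
    K.Chain R (p + 1) →ₗ[R] K.Chain R p :=
  Finsupp.linearCombination R fun σ : K.Simplex (p + 1) =>
    ∑ x : {x // x ∈ σ.1},
      Finsupp.single (σ.face x) ((-1 : R) ^ (σ.1.filter (fun y => y < x.1)).card)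

/-- The `p`-cycles: the kernel of the boundary map on `p`-chains, which is zero for `p = 0`. -/
noncomputable def cycles (R : Type w) [CommRing R] (K : PreAbstractSimplicialComplex V) :
    (p : ℕ) → Submodule R (K.Chain R p)
  | 0 => ⊤
  | p + 1 => LinearMap.ker (boundary R K p)

/-- The `p`-boundaries: the image of the boundary map on `(p + 1)`-chains. -/
noncomputable def boundaries (R : Type w) [CommRing R] (K : PreAbstractSimplicialComplex V)
    (p : ℕ) : Submodule R (K.Chain R p) :=
  LinearMap.range (boundary R K p)

/-- The boundary of a boundary is zero. -/
theorem boundary_comp_boundary (R : Type w) [CommRing R] (K : PreAbstractSimplicialComplex V)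
    (p : ℕ) : boundary R K p ∘ₗ boundary R K (p + 1) = 0 := by
  refine Finsupp.lhom_ext' fun σ => LinearMap.ext_ring ?_
  simp only [boundary, LinearMap.comp_apply, Finsupp.lsingle_apply,
    Finsupp.linearCombination_single, one_smul, map_sum, Finset.smul_sum, LinearMap.zero_apply,
    Finsupp.smul_single, smul_eq_mul]
  rw [← Finset.sum_sigma (Finset.univ : Finset {x // x ∈ σ.1}) (fun _ => Finset.univ)
    (fun a : (x : {x // x ∈ σ.1}) × {y // y ∈ (σ.face x).1} =>
      Finsupp.single ((σ.face a.1).face a.2)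
        ((-1 : R) ^ (σ.1.filter (fun y => y < a.1.1)).card *
          (-1 : R) ^ ((σ.face a.1).1.filter (fun y => y < a.2.1)).card))]
  refine Finset.sum_involution
    (fun a _ => ⟨⟨a.2.1, Finset.mem_of_mem_erase a.2.2⟩,
      ⟨a.1.1, Finset.mem_erase.2 ⟨(Finset.ne_of_mem_erase a.2.2).symm, a.1.2⟩⟩⟩)
    ?_ ?_ (fun _ _ => Finset.mem_sigma.2 ⟨Finset.mem_univ _, Finset.mem_univ _⟩)
    (fun _ _ => rfl)
  · rintro ⟨⟨x, hx⟩, ⟨y, hy⟩⟩ -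
    have hyx : y ≠ x := Finset.ne_of_mem_erase hy
    have hy' : y ∈ σ.1 := Finset.mem_of_mem_erase hy
    have key : ∀ a b : V, a ∈ σ.1 → a < b →
        (σ.1.filter (fun z => z < b)).card = ((σ.1.erase a).filter (fun z => z < b)).card + 1 ∧
        ((σ.1.erase b).filter (fun z => z < a)).card = (σ.1.filter (fun z => z < a)).card := by
      intro a b ha hab
      constructor
      · rw [Finset.filter_erase, Finset.card_erase_add_one (Finset.mem_filter.2 ⟨ha, hab⟩)]
      · rw [Finset.filter_erase, Finset.erase_eq_of_notMem]
        exact fun h => lt_asymm hab (Finset.mem_filter.1 h).2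
    have hface : (σ.face ⟨y, hy'⟩).face ⟨x, Finset.mem_erase.2 ⟨hyx.symm, hx⟩⟩ =
        (σ.face ⟨x, hx⟩).face ⟨y, hy⟩ := Subtype.ext Finset.erase_right_comm
    simp only [hface]
    rw [← Finsupp.single_add, Finsupp.single_eq_zero]
    simp only [Simplex.face]
    rcases lt_or_gt_of_ne hyx with h | h
    · obtain ⟨h1, h2⟩ := key y x hy' h
      rw [h1, h2]; ring
    · obtain ⟨h1, h2⟩ := key x y hx h
      rw [h1, h2]; ring
  · rintro ⟨⟨x, hx⟩, ⟨y, hy⟩⟩ - - h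
    exact Finset.ne_of_mem_erase hy (congrArg (fun a => a.1.1) h)

/-- Every boundary is a cycle. -/
theorem boundaries_le_cycles (R : Type w) [CommRing R] (K : PreAbstractSimplicialComplex V) :
    ∀ p : ℕ, boundaries R K p ≤ cycles R K p
  | 0 => le_top
  | p + 1 => LinearMap.range_le_ker_iff.2 (boundary_comp_boundary R K p)

/-- The `p`-th simplicial homology of `K` with coefficients in `R`: the `p`-cycles modulo the
`p`-boundaries. -/
abbrev Homology (R : Type w) [CommRing R] (K : PreAbstractSimplicialComplex V) (p : ℕ) :
    Type (max u w) :=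
  cycles R K p ⧸ (boundaries R K p).submoduleOf (cycles R K p)

end PreAbstractSimplicialComplex

namespace IndexedHypergraph

/-- The closure homology of a hypergraph: the simplicial homology of its upper closure. -/
abbrev ClosureHomology (R : Type w) [CommRing R] {V : Type u} {E : Type v} [LinearOrder V]
    (H : IndexedHypergraph V E) (p : ℕ) : Type (max u w) :=
  H.upperClosure.Homology R p

end IndexedHypergraph

/-! Both closures are full subcomplexes of one complex, `bicliqueComplex`, on the disjoint union of
vertices and hyperedges; each inclusion induces an isomorphism on homology, as in Dowker's duality
for relations. The common reason is `HasApex`. Let `Y` be one of the two sides. The part `σ` of a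
simplex outside `Y`, if nonempty, determines an apex in `Y` that can be added to every simplex with
outer part `σ`. Coning with these apexes gives an operator `h` (`contraction`), and `push` is `1 -
∂h - h∂`. It commutes with `∂`, fixes chains in `Y`, and lowers the maximal number of outer elements
by one (`push_mem_nearChains`). Finitely many pushes thus move any chain of the biclique complex
into `Y`. Applied to cycles this gives surjectivity on homology, applied to bounding chains
injectivity (`nonempty_homology_equiv`). The calculation takes place on chains of all finite sets,
including `∅`, where the cone formula has no exceptional case. -/

/-! ### Augmented boundary and cones on chains of finite sets. -/

namespace FinsetChain

open Finsupp

variable {X : Type u} [LinearOrder X] (R : Type w) [CommRing R]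

/-- The sign with which the vertex `x` is omitted from, or added to, the finite set `s`. -/
def sign (s : Finset X) (x : X) : R :=
  (-1) ^ (s.filter (fun y => y < x)).card

/-- The augmented boundary map on the chains spanned by all finite sets. -/
noncomputable def bd : (Finset X →₀ R) →ₗ[R] (Finset X →₀ R) :=
  Finsupp.linearCombination R fun s => ∑ x ∈ s, single (s.erase x) (sign R s x)

/-- The cone with apex `a`. -/
noncomputable def cone (a : X) : (Finset X →₀ R) →ₗ[R] (Finset X →₀ R) :=
  Finsupp.linearCombination R fun s => if a ∈ s then 0 else single (insert a s) (sign R s a)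

variable {R}

theorem sign_mul_self (s : Finset X) (x : X) : sign R s x * sign R s x = 1 := by
  rw [sign, ← mul_pow]; simp

theorem sign_insert_self (s : Finset X) (x : X) : sign R (insert x s) x = sign R s x := by
  simp [sign, Finset.filter_insert]

theorem sign_erase_self (s : Finset X) (x : X) : sign R (s.erase x) x = sign R s x := by
  rw [sign, Finset.filter_erase, Finset.erase_eq_of_notMem (by simp), sign]

theorem sign_insert {s : Finset X} {a x : X} (ha : a ∉ s) :
    sign R (insert a s) x = (if a < x then -1 else 1) * sign R s x := by
  rw [sign, Finset.filter_insert]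
  split_ifs with h
  · rw [Finset.card_insert_of_notMem (by simp [ha]), pow_succ', sign]
  · rw [sign, one_mul]

theorem sign_insert_mul_sign {s : Finset X} {a x : X} (ha : a ∉ s) (hx : x ∈ s) :
    sign R s a * sign R (insert a s) x + sign R s x * sign R (s.erase x) a = 0 := by
  have hax : a ≠ x := fun h => ha (h ▸ hx)
  have h := sign_insert (R := R) (x := a) (Finset.notMem_erase x s)
  rw [Finset.insert_erase hx] at h
  rw [sign_insert ha, h]
  rcases lt_or_gt_of_ne hax with hlt | hlt
  · rw [if_pos hlt, if_neg hlt.not_gt]; ring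
  · rw [if_pos hlt, if_neg hlt.not_gt]; ring

theorem bd_single (s : Finset X) (r : R) :
    bd R (single s r) = r • ∑ x ∈ s, single (s.erase x) (sign R s x) := by
  simp [bd]

theorem cone_single (a : X) (s : Finset X) (r : R) :
    cone R a (single s r) = if a ∈ s then 0 else single (insert a s) (r * sign R s a) := by
  simp only [cone, Finsupp.linearCombination_single]
  split_ifs <;> simp

/-- If `a ∈ s`, only the face omitting `a` survives coning, and it returns `s`. If `a ∉ s`, the face
of the cone opposite `a` is `s`, and the other faces cancel by `sign_insert_mul_sign`. -/
theorem bd_cone_add_cone_bd_single (a : X) (s : Finset X) :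
    bd R (cone R a (single s 1)) + cone R a (bd R (single s 1)) = single s (1 : R) := by
  rw [cone_single, bd_single, one_smul, map_sum]
  simp only [cone_single]
  split_ifs with ha
  · rw [map_zero, zero_add, Finset.sum_eq_single_of_mem a ha]
    · rw [if_neg (Finset.notMem_erase a s), Finset.insert_erase ha, sign_erase_self,
        sign_mul_self]
    · intro x _ hxa
      rw [if_pos (Finset.mem_erase.2 ⟨hxa.symm, ha⟩)]
  · rw [bd_single, Finset.sum_insert ha, Finset.erase_insert ha, sign_insert_self, smul_add,
      one_mul, smul_single, smul_eq_mul, sign_mul_self, add_assoc, Finset.smul_sum,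
      ← Finset.sum_add_distrib, Finset.sum_eq_zero, add_zero]
    intro x hx
    have hax : a ≠ x := fun h => ha (h ▸ hx)
    rw [if_neg (fun h => ha (Finset.mem_of_mem_erase h)), Finset.erase_insert_of_ne hax,
      smul_single, ← single_add, smul_eq_mul, sign_insert_mul_sign ha hx, single_zero]

theorem bd_cone_add_cone_bd (a : X) (z : Finset X →₀ R) :
    bd R (cone R a z) + cone R a (bd R z) = z := by
  suffices h : bd R ∘ₗ cone R a + cone R a ∘ₗ bd R = LinearMap.id from LinearMap.congr_fun h z
  exact Finsupp.lhom_ext' fun s => LinearMap.ext_ring (bd_cone_add_cone_bd_single a s)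

/-- A nonempty set is, up to sign, a cone over a smaller one, so the cone formula, used for `s` and
for its boundary, replaces the usual double sum. -/
theorem bd_bd_single (s : Finset X) : bd R (bd R (single s 1)) = 0 := by
  induction s using Finset.induction_on with
  | empty => simp [bd_single]
  | insert a s ha ih =>
    have h : single (insert a s) (1 : R) = sign R s a • cone R a (single s 1) := by
      rw [cone_single, if_neg ha, one_mul, smul_single, smul_eq_mul, sign_mul_self]
    have h1 := bd_cone_add_cone_bd a (single s (1 : R))
    have h2 := bd_cone_add_cone_bd a (bd R (single s (1 : R)))
    rw [ih, map_zero, add_zero] at h2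
    rw [h, map_smul, map_smul, eq_sub_of_add_eq h1, map_sub, h2, sub_self, smul_zero]

theorem bd_bd (z : Finset X →₀ R) : bd R (bd R z) = 0 := by
  suffices h : bd R ∘ₗ bd R = (0 : (Finset X →₀ R) →ₗ[R] (Finset X →₀ R)) from
    LinearMap.congr_fun h z
  exact Finsupp.lhom_ext' fun s => LinearMap.ext_ring (bd_bd_single s)

end FinsetChain

/-! ### Pushing chains into a set of vertices that contains apexes. -/

namespace FinsetChain

open Finsupp

variable {X : Type u} {R : Type w} [CommRing R]

theorem map_mem_of_mem_supported {S : Set (Finset X)} {M : Submodule R (Finset X →₀ R)}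
    (f : (Finset X →₀ R) →ₗ[R] (Finset X →₀ R)) (h : ∀ s ∈ S, f (single s 1) ∈ M)
    {z : Finset X →₀ R} (hz : z ∈ supported R R S) : f z ∈ M := by
  rw [supported_eq_span_single] at hz
  have hle : Submodule.span R ((fun i => single i (1 : R)) '' S) ≤ M.comap f :=
    Submodule.span_le.2 (by rintro _ ⟨s, hs, rfl⟩; exact h s hs)
  exact hle hz

theorem empty_notMem_faces (J : PreAbstractSimplicialComplex X) : ∅ ∉ J.faces :=
  fun h => Finset.not_nonempty_empty (J.isRelLowerSet_faces h).1

theorem mem_faces_of_subset {J : PreAbstractSimplicialComplex X} {s t : Finset X}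
    (hs : s ∈ J.faces) (hts : t ⊆ s)
    (ht : t.Nonempty) : t ∈ J.faces :=
  (J.isRelLowerSet_faces hs).2 hts ht

open Classical in
/-- The part of a finite set outside `Y`. -/
noncomputable def outer (Y : Set X) (s : Finset X) : Finset X := s.filter (· ∉ Y)

theorem mem_outer {Y : Set X} {s : Finset X} {x : X} : x ∈ outer Y s ↔ x ∈ s ∧ x ∉ Y := by
  simp [outer]

theorem outer_subset (Y : Set X) (s : Finset X) : outer Y s ⊆ s := fun _ h => (mem_outer.1 h).1

theorem outer_eq_empty_iff {Y : Set X} {s : Finset X} : outer Y s = ∅ ↔ ∀ x ∈ s, x ∈ Y := by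
  simp [Finset.eq_empty_iff_forall_notMem, mem_outer]

variable {J : PreAbstractSimplicialComplex X} {Y : Set X}

/-- The chains of cardinality `k` of the complex `J`, augmented by the empty set. -/
noncomputable def cardChains (R : Type w) [CommRing R] (J : PreAbstractSimplicialComplex X)
    (k : ℕ) : Submodule R (Finset X →₀ R) :=
  supported R R {s | (s.Nonempty → s ∈ J.faces) ∧ s.card = k}

/-- The chains spanned by the finite sets with at most `m` elements outside `Y`. -/
noncomputable def nearChains (R : Type w) [CommRing R] (Y : Set X) (m : ℕ) :
    Submodule R (Finset X →₀ R) :=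
  supported R R {s | (outer Y s).card ≤ m}

theorem mem_nearChains_of_mem_cardChains {k : ℕ} {z : Finset X →₀ R}
    (hz : z ∈ cardChains R J k) : z ∈ nearChains R Y k := by
  refine supported_mono ?_ hz
  rintro s ⟨-, hs⟩
  exact (Finset.card_le_card (outer_subset Y s)).trans hs.le

variable [LinearOrder X]

theorem outer_insert {a : X} (ha : a ∈ Y) (s : Finset X) :
    outer Y (insert a s) = outer Y s := by
  classical rw [outer, Finset.filter_insert, if_neg (not_not.2 ha), outer]

theorem outer_erase (Y : Set X) (a : X) (s : Finset X) :
    outer Y (s.erase a) = (outer Y s).erase a := by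
  classical rw [outer, Finset.filter_erase, outer]

theorem outer_erase_of_mem {a : X} (ha : a ∈ Y) (s : Finset X) :
    outer Y (s.erase a) = outer Y s := by
  rw [outer_erase, Finset.erase_eq_of_notMem (fun h => (mem_outer.1 h).2 ha)]

/-- Every simplex can be coned off, inside `J`, by a vertex in `Y` that depends only on the part of
the simplex outside `Y`. -/
def HasApex (J : PreAbstractSimplicialComplex X) (Y : Set X) : Prop :=
  ∀ σ ∈ J.faces, ∃ a ∈ Y, ∀ s ∈ J.faces, outer Y s = σ → insert a s ∈ J.faces

open Classical in
/-- The operator that cones off the simplices that do not lie in `Y`. -/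
noncomputable def contraction (R : Type w) [CommRing R] (H : HasApex J Y) :
    (Finset X →₀ R) →ₗ[R] (Finset X →₀ R) :=
  Finsupp.linearCombination R fun s =>
    if hs : outer Y s ∈ J.faces then cone R (H _ hs).choose (single s 1) else 0

theorem contraction_single_of_mem (H : HasApex J Y) {s : Finset X} (hs : outer Y s ∈ J.faces) :
    contraction R H (single s 1) = cone R (H _ hs).choose (single s 1) := by
  simp [contraction, hs]

theorem contraction_single_of_notMem (H : HasApex J Y) {s : Finset X}
    (hs : outer Y s ∉ J.faces) (r : R) : contraction R H (single s r) = 0 := by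
  simp [contraction, hs]

/-- The chosen apex depends on the outer part alone; this produces the cancellation in
`push_single_mem_nearChains`. -/
theorem contraction_single_eq_cone (H : HasApex J Y) {s t : Finset X} (ht : outer Y t ∈ J.faces)
    (hst : outer Y s = outer Y t) (r : R) :
    contraction R H (single s r) = cone R (H _ ht).choose (single s r) := by
  have hs : outer Y s ∈ J.faces := hst ▸ ht
  rw [← mul_one r, ← smul_eq_mul, ← smul_single, map_smul, map_smul,
    contraction_single_of_mem H hs]
  simp only [hst]

/-- The chain map, chain homotopic to the identity, that moves chains towards `Y`. -/
noncomputable def push (R : Type w) [CommRing R] (H : HasApex J Y) :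
    (Finset X →₀ R) →ₗ[R] (Finset X →₀ R) :=
  LinearMap.id - bd R ∘ₗ contraction R H - contraction R H ∘ₗ bd R

theorem push_apply (H : HasApex J Y) (z : Finset X →₀ R) :
    push R H z = z - bd R (contraction R H z) - contraction R H (bd R z) := rfl

theorem bd_push (H : HasApex J Y) (z : Finset X →₀ R) : bd R (push R H z) = push R H (bd R z) := by
  simp [push_apply, bd_bd]

theorem bd_mem_cardChains {k : ℕ} {z : Finset X →₀ R} (hz : z ∈ cardChains R J (k + 1)) :
    bd R z ∈ cardChains R J k := by
  refine map_mem_of_mem_supported _ ?_ hz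
  rintro s ⟨hs, hc⟩
  rw [bd_single]
  refine Submodule.smul_mem _ _ (Submodule.sum_mem _ fun x hx => single_mem_supported R _ ⟨?_, ?_⟩)
  · exact mem_faces_of_subset (hs ⟨x, hx⟩) (Finset.erase_subset _ _)
  · rw [Finset.card_erase_of_mem hx, hc]; rfl

theorem contraction_mem_cardChains (H : HasApex J Y) {k : ℕ} {z : Finset X →₀ R}
    (hz : z ∈ cardChains R J k) : contraction R H z ∈ cardChains R J (k + 1) := by
  refine map_mem_of_mem_supported _ ?_ hz
  rintro s ⟨hs, hc⟩
  by_cases ho : outer Y s ∈ J.faces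
  · rw [contraction_single_of_mem H ho, cone_single]
    split_ifs with ha
    · exact zero_mem _
    · have hne : s.Nonempty := (J.isRelLowerSet_faces ho).1.mono (outer_subset Y s)
      exact single_mem_supported R _ ⟨fun _ => (H _ ho).choose_spec.2 s (hs hne) rfl,
        by rw [Finset.card_insert_of_notMem ha, hc]⟩
  · rw [contraction_single_of_notMem H ho]; exact zero_mem _

/-- Sets inside `Y` have outer part `∅`, which is never a face, so the default value `0` applies. -/
theorem contraction_eq_zero (H : HasApex J Y) {z : Finset X →₀ R} (hz : z ∈ nearChains R Y 0) :
    contraction R H z = 0 := by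
  refine (Submodule.mem_bot R).1 (map_mem_of_mem_supported _ (fun s hs => ?_) hz)
  have ho : outer Y s = ∅ := Finset.card_eq_zero.1 (Nat.le_zero.1 hs)
  rw [contraction_single_of_notMem H (ho ▸ empty_notMem_faces J)]
  exact zero_mem _

theorem bd_mem_nearChains {m : ℕ} {z : Finset X →₀ R} (hz : z ∈ nearChains R Y m) :
    bd R z ∈ nearChains R Y m := by
  refine map_mem_of_mem_supported _ (fun s hs => ?_) hz
  rw [bd_single]
  refine Submodule.smul_mem _ _ (Submodule.sum_mem _ fun x hx => single_mem_supported R _ ?_)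
  exact (Finset.card_le_card (by rw [outer_erase]; exact Finset.erase_subset _ _)).trans hs

theorem push_eq_self (H : HasApex J Y) {z : Finset X →₀ R} (hz : z ∈ nearChains R Y 0) :
    push R H z = z := by
  rw [push_apply, contraction_eq_zero H hz, contraction_eq_zero H (bd_mem_nearChains hz)]
  simp

theorem cone_mem_nearChains {a : X} (ha : a ∈ Y) {s : Finset X} {m : ℕ}
    (hs : (outer Y s).card ≤ m) (r : R) : cone R a (single s r) ∈ nearChains R Y m := by
  rw [cone_single]
  split_ifs
  · exact zero_mem _
  · exact single_mem_supported R _ (by rwa [Set.mem_ofPred_eq, outer_insert ha])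

theorem contraction_single_mem_nearChains (H : HasApex J Y) {s : Finset X} {m : ℕ}
    (hs : (outer Y s).card ≤ m) (r : R) : contraction R H (single s r) ∈ nearChains R Y m := by
  by_cases ho : outer Y s ∈ J.faces
  · rw [contraction_single_eq_cone H ho rfl]
    exact cone_mem_nearChains (H _ ho).choose_spec.1 hs r
  · rw [contraction_single_of_notMem H ho]; exact zero_mem _

/-- With `a` the apex of `s`, the cone formula turns `push s` into `cone a (∂s) - h(∂s)`. Faces
omitting an element of `Y` keep the apex and cancel; the others have one outer element fewer. -/
theorem push_single_mem_nearChains (H : HasApex J Y) {s : Finset X} {m : ℕ}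
    (ho : outer Y s ∈ J.faces) (hs : (outer Y s).card ≤ m + 1) :
    push R H (single s 1) ∈ nearChains R Y m := by
  rw [push_apply, contraction_single_of_mem H ho,
    ← eq_sub_of_add_eq' (bd_cone_add_cone_bd (H _ ho).choose (single s (1 : R))),
    bd_single, one_smul, map_sum, map_sum, ← Finset.sum_sub_distrib]
  refine Submodule.sum_mem _ fun x hx => ?_
  by_cases hxY : x ∈ Y
  · rw [contraction_single_eq_cone H ho (outer_erase_of_mem hxY s), sub_self]
    exact zero_mem _
  · have hc : (outer Y (s.erase x)).card ≤ m := by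
      rw [outer_erase, Finset.card_erase_of_mem (mem_outer.2 ⟨hx, hxY⟩)]
      omega
    exact sub_mem (cone_mem_nearChains (H _ ho).choose_spec.1 hc _)
      (contraction_single_mem_nearChains H hc _)

theorem push_mem_nearChains (H : HasApex J Y) {k m : ℕ} {z : Finset X →₀ R}
    (hz : z ∈ cardChains R J k) (hm : z ∈ nearChains R Y (m + 1)) :
    push R H z ∈ nearChains R Y m := by
  have hzm : z ∈ supported R R ({s | (s.Nonempty → s ∈ J.faces) ∧ s.card = k} ∩
      {s | (outer Y s).card ≤ m + 1}) := by
    rw [supported_inter]; exact ⟨hz, hm⟩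
  refine map_mem_of_mem_supported _ ?_ hzm
  rintro s ⟨⟨hs, -⟩, hsm⟩
  rcases (outer Y s).eq_empty_or_nonempty with ho | ho
  · rw [push_eq_self H (single_mem_supported R _ (by simp [ho]))]
    exact single_mem_supported R _ (by simp [ho])
  · exact push_single_mem_nearChains H
      (mem_faces_of_subset (hs (ho.mono (outer_subset Y s))) (outer_subset Y s) ho) hsm

theorem push_mem_cardChains (H : HasApex J Y) {k : ℕ} {z : Finset X →₀ R}
    (hz : z ∈ cardChains R J (k + 1)) : push R H z ∈ cardChains R J (k + 1) :=
  sub_mem (sub_mem hz (bd_mem_cardChains (contraction_mem_cardChains H hz)))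
    (contraction_mem_cardChains H (bd_mem_cardChains hz))

theorem push_iterate_mem (H : HasApex J Y) {k : ℕ} (m : ℕ) {z : Finset X →₀ R}
    (hz : z ∈ cardChains R J (k + 1)) (hm : z ∈ nearChains R Y m) :
    (push R H)^[m] z ∈ cardChains R J (k + 1) ∧ (push R H)^[m] z ∈ nearChains R Y 0 := by
  induction m generalizing z with
  | zero => exact ⟨hz, hm⟩
  | succ m ih =>
    exact ih (push_mem_cardChains H hz) (push_mem_nearChains H hz hm)

theorem bd_push_iterate (H : HasApex J Y) (m : ℕ) (z : Finset X →₀ R) :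
    bd R ((push R H)^[m] z) = (push R H)^[m] (bd R z) := by
  induction m generalizing z with
  | zero => rfl
  | succ m ih => rw [Function.iterate_succ_apply, ih, bd_push, ← Function.iterate_succ_apply]

/-- Each push changes `z` by a boundary, which preserves `hbd`, and the changes add up. Requiring
`bd R z = 0` would exclude 0-cycles, whose augmented boundary may be a nonzero multiple of `∅`. -/
theorem exists_sub_push_iterate_eq_bd (H : HasApex J Y) {k : ℕ} (m : ℕ) {z : Finset X →₀ R}
    (hz : z ∈ cardChains R J (k + 1)) (hbd : contraction R H (bd R z) = 0) :
    ∃ c ∈ cardChains R J (k + 2), z - (push R H)^[m] z = bd R c := by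
  induction m generalizing z with
  | zero => exact ⟨0, zero_mem _, by simp⟩
  | succ m ih =>
    have hp : push R H z = z - bd R (contraction R H z) := by rw [push_apply, hbd, sub_zero]
    obtain ⟨c, hc, h⟩ := ih (push_mem_cardChains H hz) (by rw [hp, map_sub, bd_bd, sub_zero, hbd])
    refine ⟨contraction R H z + c, add_mem (contraction_mem_cardChains H hz) hc, ?_⟩
    rw [Function.iterate_succ_apply, map_add, ← h, hp]
    abel

end FinsetChain

/-! ### Transfer to simplicial homology. -/

namespace FinsetChain

open Finsupp PreAbstractSimplicialComplex

variable {V : Type u} {X : Type v} [LinearOrder V] [LinearOrder X] {R : Type w} [CommRing R]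
  {K : PreAbstractSimplicialComplex V} {J : PreAbstractSimplicialComplex X}

/-- The chains of `K` as chains spanned by finite sets, along an embedding of the vertices. -/
noncomputable def ofChain (R : Type w) [CommRing R] (f : V ↪o X)
    (K : PreAbstractSimplicialComplex V) (p : ℕ) : K.Chain R p →ₗ[R] (Finset X →₀ R) :=
  Finsupp.lmapDomain R R fun σ : K.Simplex p => σ.1.map f.toEmbedding

theorem ofChain_single (f : V ↪o X) {p : ℕ} (σ : K.Simplex p) (r : R) :
    ofChain R f K p (single σ r) = single (σ.1.map f.toEmbedding) r := by
  simp [ofChain, Finsupp.mapDomain_single]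

theorem ofChain_injective (f : V ↪o X) (p : ℕ) : Function.Injective (ofChain R f K p) :=
  Finsupp.mapDomain_injective fun _ _ h => Subtype.ext (Finset.map_injective _ h)

/-- Order embeddings preserve the count of preceding vertices; hence the lexicographic order on the
disjoint union later. -/
theorem sign_map (f : V ↪o X) (s : Finset V) (x : V) :
    sign R (s.map f.toEmbedding) (f x) = sign R s x := by
  simp [sign, Finset.filter_map]

theorem bd_ofChain (f : V ↪o X) (p : ℕ) (z : K.Chain R (p + 1)) :
    bd R (ofChain R f K (p + 1) z) = ofChain R f K p (boundary R K p z) := by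
  suffices h : bd R ∘ₗ ofChain R f K (p + 1) = ofChain R f K p ∘ₗ boundary R K p from
    LinearMap.congr_fun h z
  refine Finsupp.lhom_ext' fun σ => LinearMap.ext_ring ?_
  simp only [LinearMap.comp_apply, Finsupp.lsingle_apply, ofChain_single, bd_single, one_smul,
    boundary, Finsupp.linearCombination_single, map_sum, Finset.sum_map]
  rw [← Finset.sum_coe_sort]
  refine Finset.sum_congr rfl fun x _ => ?_
  congr 1
  · exact (Finset.map_erase f.toEmbedding σ.1 x.1).symm
  · exact sign_map f σ.1 x.1

theorem ofChain_mem_cardChains (f : V ↪o X)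
    (hK : ∀ s : Finset V, s ∈ K.faces ↔ s.map f.toEmbedding ∈ J.faces) {p : ℕ}
    (z : K.Chain R p) : ofChain R f K p z ∈ cardChains R J (p + 1) := by
  induction z using Finsupp.induction_linear with
  | zero => simp
  | add a b ha hb => rw [map_add]; exact add_mem ha hb
  | single σ r =>
    rw [ofChain_single]
    exact single_mem_supported R _ ⟨fun _ => (hK _).1 σ.2.1, by rw [Finset.card_map, σ.2.2]⟩

theorem ofChain_mem_nearChains (f : V ↪o X) {p : ℕ} (z : K.Chain R p) :
    ofChain R f K p z ∈ nearChains R (Set.range f) 0 := by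
  induction z using Finsupp.induction_linear with
  | zero => simp
  | add a b ha hb => rw [map_add]; exact add_mem ha hb
  | single σ r =>
    rw [ofChain_single]
    refine single_mem_supported R _ (Finset.card_eq_zero.2 (outer_eq_empty_iff.2 ?_)).le
    simp

theorem exists_ofChain_eq (f : V ↪o X)
    (hK : ∀ s : Finset V, s ∈ K.faces ↔ s.map f.toEmbedding ∈ J.faces) {p : ℕ}
    {z : Finset X →₀ R} (hz : z ∈ cardChains R J (p + 1))
    (hY : z ∈ nearChains R (Set.range f) 0) : ∃ c, ofChain R f K p c = z := by
  have h : z ∈ supported R R ({s | (s.Nonempty → s ∈ J.faces) ∧ s.card = p + 1} ∩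
      {s | (outer (Set.range f) s).card ≤ 0}) := by
    rw [supported_inter]; exact ⟨hz, hY⟩
  refine map_mem_of_mem_supported (M := LinearMap.range (ofChain R f K p)) LinearMap.id ?_ h
  rintro s ⟨⟨hs, hc⟩, ho⟩
  obtain ⟨t, rfl⟩ : ∃ t : Finset V, t.map f.toEmbedding = s := by
    have hr := outer_eq_empty_iff.1 (Finset.card_eq_zero.1 (Nat.le_zero.1 ho))
    refine ⟨s.preimage f f.injective.injOn, Finset.ext fun x => ?_⟩
    simp only [Finset.mem_map, Finset.mem_preimage, RelEmbedding.coe_toEmbedding]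
    refine ⟨by rintro ⟨v, hv, rfl⟩; exact hv, fun hx => ?_⟩
    obtain ⟨v, rfl⟩ := hr x hx
    exact ⟨v, hx, rfl⟩
  rw [Finset.card_map] at hc
  have ht : t.Nonempty := Finset.card_pos.1 (by omega)
  exact ⟨single ⟨t, (hK t).2 (hs (ht.map)), hc⟩ 1, ofChain_single f _ 1⟩

/-- The map induced on simplices by an embedding of simplicial complexes. -/
def simplexMap (f : V ↪o X)
    (hK : ∀ s : Finset V, s ∈ K.faces ↔ s.map f.toEmbedding ∈ J.faces) (p : ℕ)
    (σ : K.Simplex p) : J.Simplex p :=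
  ⟨σ.1.map f.toEmbedding, (hK _).1 σ.2.1, by rw [Finset.card_map, σ.2.2]⟩

/-- The map induced on chains by an embedding of simplicial complexes. -/
noncomputable def chainMap (R : Type w) [CommRing R] (f : V ↪o X)
    (hK : ∀ s : Finset V, s ∈ K.faces ↔ s.map f.toEmbedding ∈ J.faces) (p : ℕ) :
    K.Chain R p →ₗ[R] J.Chain R p :=
  Finsupp.lmapDomain R R (simplexMap f hK p)

theorem ofChain_chainMap (f : V ↪o X)
    (hK : ∀ s : Finset V, s ∈ K.faces ↔ s.map f.toEmbedding ∈ J.faces) (p : ℕ)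
    (z : K.Chain R p) :
    ofChain R (RelEmbedding.refl _) J p (chainMap R f hK p z) = ofChain R f K p z := by
  induction z using Finsupp.induction_linear with
  | zero => simp
  | add a b ha hb => simp only [map_add, ha, hb]
  | single σ r =>
    rw [chainMap, lmapDomain_apply, mapDomain_single, ofChain_single, ofChain_single]
    congr 1
    exact Finset.map_refl

theorem boundary_chainMap (f : V ↪o X)
    (hK : ∀ s : Finset V, s ∈ K.faces ↔ s.map f.toEmbedding ∈ J.faces) (p : ℕ)
    (z : K.Chain R (p + 1)) :
    boundary R J p (chainMap R f hK (p + 1) z) = chainMap R f hK p (boundary R K p z) := by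
  apply ofChain_injective (RelEmbedding.refl _)
  rw [← bd_ofChain, ofChain_chainMap, ofChain_chainMap, bd_ofChain]

theorem chainMap_mem_cycles (f : V ↪o X)
    (hK : ∀ s : Finset V, s ∈ K.faces ↔ s.map f.toEmbedding ∈ J.faces) :
    ∀ (p : ℕ) {z : K.Chain R p}, z ∈ cycles R K p → chainMap R f hK p z ∈ cycles R J p
  | 0, _, _ => Submodule.mem_top
  | p + 1, z, hz => by
    rw [cycles, LinearMap.mem_ker] at hz ⊢
    rw [boundary_chainMap, hz, map_zero]

theorem map_refl_mem_faces (s : Finset X) :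
    s ∈ J.faces ↔ s.map (RelEmbedding.refl (· ≤ ·) : X ↪o X).toEmbedding ∈ J.faces := by
  rw [show s.map (RelEmbedding.refl (· ≤ ·) : X ↪o X).toEmbedding = s from Finset.map_refl]

theorem exists_ofChain_refl_eq {p : ℕ} {z : Finset X →₀ R} (hz : z ∈ cardChains R J (p + 1)) :
    ∃ c, ofChain R (RelEmbedding.refl _) J p c = z := by
  -- For the identity embedding `Y` is everything, so all outer parts are empty.
  refine exists_ofChain_eq _ map_refl_mem_faces hz (supported_mono ?_ (mem_supported_support R z))
  intro s _
  exact (Finset.card_eq_zero.2 (outer_eq_empty_iff.2 fun x _ => Set.mem_range_self x)).le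

theorem contraction_bd_ofChain {Y : Set X} (H : HasApex J Y) :
    ∀ (p : ℕ) {z : J.Chain R p}, z ∈ cycles R J p →
      contraction R H (bd R (ofChain R (RelEmbedding.refl _) J p z)) = 0
  | 0, z, _ => contraction_eq_zero H (mem_nearChains_of_mem_cardChains
      (bd_mem_cardChains (ofChain_mem_cardChains _ map_refl_mem_faces z)))
  | p + 1, z, hz => by
    rw [cycles, LinearMap.mem_ker] at hz
    rw [bd_ofChain, hz, map_zero, map_zero]

theorem mem_cycles_of_ofChain_eq (f : V ↪o X) {Y : Set X} (H : HasApex J Y) (m : ℕ) :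
    ∀ (p : ℕ) {c : K.Chain R p} {z : J.Chain R p}, z ∈ cycles R J p →
      ofChain R f K p c = (push R H)^[m] (ofChain R (RelEmbedding.refl _) J p z) →
      c ∈ cycles R K p
  | 0, _, _, _, _ => Submodule.mem_top
  | p + 1, c, z, hz, h => by
    rw [cycles, LinearMap.mem_ker] at hz ⊢
    apply ofChain_injective f
    rw [← bd_ofChain, h, bd_push_iterate, bd_ofChain, hz, map_zero, iterate_map_zero, map_zero]

/-- If every simplex of `J` can be coned off by a vertex of the full subcomplex `K`, then every
cycle of `J` is homologous to a cycle of `K`. -/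
theorem exists_chainMap_sub_mem_boundaries (f : V ↪o X)
    (hK : ∀ s : Finset V, s ∈ K.faces ↔ s.map f.toEmbedding ∈ J.faces)
    (H : HasApex J (Set.range f)) (p : ℕ) {z : J.Chain R p} (hz : z ∈ cycles R J p) :
    ∃ c ∈ cycles R K p, chainMap R f hK p c - z ∈ boundaries R J p := by
  have hm := ofChain_mem_cardChains (RelEmbedding.refl _) map_refl_mem_faces z
  -- A `p`-simplex has at most `p + 1` outer vertices, so `p + 1` pushes suffice.
  obtain ⟨h1, h2⟩ := push_iterate_mem H (p + 1) hm (mem_nearChains_of_mem_cardChains hm)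
  obtain ⟨c, hc⟩ := exists_ofChain_eq f hK h1 h2
  obtain ⟨b, hb, hzb⟩ :=
    exists_sub_push_iterate_eq_bd H (p + 1) hm (contraction_bd_ofChain H p hz)
  obtain ⟨d, rfl⟩ := exists_ofChain_refl_eq hb
  refine ⟨c, mem_cycles_of_ofChain_eq f H (p + 1) p hz hc, -d, ?_⟩
  apply ofChain_injective (RelEmbedding.refl _)
  rw [map_neg, map_neg, ← bd_ofChain, ← hzb, map_sub, ofChain_chainMap, hc]
  abel

theorem mem_boundaries_of_chainMap_mem (f : V ↪o X)
    (hK : ∀ s : Finset V, s ∈ K.faces ↔ s.map f.toEmbedding ∈ J.faces)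
    (H : HasApex J (Set.range f)) (p : ℕ) {c : K.Chain R p}
    (hc : chainMap R f hK p c ∈ boundaries R J p) : c ∈ boundaries R K p := by
  obtain ⟨t, ht⟩ := hc
  have hm := ofChain_mem_cardChains (RelEmbedding.refl _) map_refl_mem_faces t
  -- The bounding chain `t` is pushed into `K`; its boundary comes from `c`, already in `K`, and
  -- stays fixed.
  obtain ⟨h1, h2⟩ := push_iterate_mem H (p + 2) hm (mem_nearChains_of_mem_cardChains hm)
  obtain ⟨d, hd⟩ := exists_ofChain_eq f hK h1 h2
  refine ⟨d, ofChain_injective f p ?_⟩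
  rw [← bd_ofChain, hd, bd_push_iterate, bd_ofChain, ht, ofChain_chainMap]
  exact Function.iterate_fixed (push_eq_self H (ofChain_mem_nearChains f c)) _

/-- If every simplex of `J` can be coned off by a vertex of the full subcomplex `K`, then `K` and
`J` have the same homology. -/
theorem nonempty_homology_equiv (R : Type w) [CommRing R] (f : V ↪o X)
    (hK : ∀ s : Finset V, s ∈ K.faces ↔ s.map f.toEmbedding ∈ J.faces)
    (H : HasApex J (Set.range f)) (p : ℕ) :
    Nonempty (K.Homology R p ≃ₗ[R] J.Homology R p) := by
  let φ : cycles R K p →ₗ[R] J.Homology R p :=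
    ((boundaries R J p).submoduleOf (cycles R J p)).mkQ ∘ₗ
      (chainMap R f hK p).restrict fun _ => chainMap_mem_cycles f hK p
  have hsurj : Function.Surjective φ := by
    intro y
    obtain ⟨⟨z, hz⟩, rfl⟩ := Submodule.mkQ_surjective _ y
    obtain ⟨c, hc, h⟩ := exists_chainMap_sub_mem_boundaries f hK H p hz
    exact ⟨⟨c, hc⟩, (Submodule.Quotient.eq _).2 h⟩
  have hker : LinearMap.ker φ = (boundaries R K p).submoduleOf (cycles R K p) := by
    ext ⟨c, hc⟩
    refine ((Submodule.Quotient.mk_eq_zero _).trans ?_ : φ ⟨c, hc⟩ = 0 ↔ _)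
    refine ⟨mem_boundaries_of_chainMap_mem f hK H p, ?_⟩
    rintro ⟨d, hd⟩
    exact ⟨chainMap R f hK (p + 1) d, (boundary_chainMap f hK p d).trans (congrArg _ hd)⟩
  exact ⟨(Submodule.quotEquivOfEq _ _ hker.symm).trans (φ.quotKerEquivOfSurjective hsurj)⟩

end FinsetChain

/-! ### The biclique complex and its two sides. -/

namespace IndexedHypergraph

variable {V : Type u} {E : Type v}

theorem mem_range_or_mem_range (x : V ⊕ₗ E) :
    (∃ v, x = Sum.inlₗ v) ∨ ∃ e, x = Sum.inrₗ e := by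
  induction x using Lex.rec with
  | _ x => exact x.rec (fun v => .inl ⟨v, rfl⟩) fun e => .inr ⟨e, rfl⟩

variable [LinearOrder V] [LinearOrder E]

/-- The complex of the finite sets of vertices and hyperedges in which every vertex lies in every
hyperedge, the vertices lie in a common hyperedge, and the hyperedges have a common vertex. -/
def bicliqueComplex (H : IndexedHypergraph V E) : PreAbstractSimplicialComplex (V ⊕ₗ E) where
  faces := {s | s.Nonempty ∧
    (∀ v e, Sum.inlₗ v ∈ s → Sum.inrₗ e ∈ s → v ∈ H.edge e) ∧
    (∃ e, ∀ v, Sum.inlₗ v ∈ s → v ∈ H.edge e) ∧ ∃ v, ∀ e, Sum.inrₗ e ∈ s → v ∈ H.edge e}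
  isRelLowerSet_faces := fun _ ⟨hs, h, ⟨e, he⟩, v, hv⟩ =>
    ⟨hs, fun _ hts ht => ⟨ht, fun v e hv he => h v e (hts hv) (hts he),
      ⟨e, fun v hv => he v (hts hv)⟩, v, fun e he => hv e (hts he)⟩⟩

/-- The vertices in the disjoint union of the vertices and the hyperedges. -/
def inlEmbedding (V : Type u) (E : Type v) [LinearOrder V] [LinearOrder E] : V ↪o V ⊕ₗ E :=
  OrderEmbedding.ofMapLEIff Sum.inlₗ fun _ _ => Sum.Lex.inl_le_inl_iff

/-- The hyperedges in the disjoint union of the vertices and the hyperedges. -/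
def inrEmbedding (V : Type u) (E : Type v) [LinearOrder V] [LinearOrder E] : E ↪o V ⊕ₗ E :=
  OrderEmbedding.ofMapLEIff Sum.inrₗ fun _ _ => Sum.Lex.inr_le_inr_iff

theorem inlₗ_mem_map_inlEmbedding {s : Finset V} {v : V} :
    Sum.inlₗ v ∈ s.map (inlEmbedding V E).toEmbedding ↔ v ∈ s :=
  Finset.mem_map' (inlEmbedding V E).toEmbedding

theorem inrₗ_mem_map_inrEmbedding {s : Finset E} {e : E} :
    Sum.inrₗ e ∈ s.map (inrEmbedding V E).toEmbedding ↔ e ∈ s :=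
  Finset.mem_map' (inrEmbedding V E).toEmbedding

theorem inrₗ_notMem_map_inlEmbedding {s : Finset V} {e : E} :
    Sum.inrₗ e ∉ s.map (inlEmbedding V E).toEmbedding := by
  rintro h
  obtain ⟨v, -, hv⟩ := Finset.mem_map.1 h
  exact Sum.inl_ne_inr (toLex.injective hv)

theorem inlₗ_notMem_map_inrEmbedding {s : Finset E} {v : V} :
    Sum.inlₗ v ∉ s.map (inrEmbedding V E).toEmbedding := by
  rintro h
  obtain ⟨e, -, he⟩ := Finset.mem_map.1 h
  exact Sum.inr_ne_inl (toLex.injective he)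

theorem mem_upperClosure_iff (H : IndexedHypergraph V E) (s : Finset V) :
    s ∈ H.upperClosure.faces ↔ s.map (inlEmbedding V E).toEmbedding ∈ H.bicliqueComplex.faces := by
  constructor
  · rintro ⟨⟨v, hv⟩, e, he⟩
    -- The common-vertex condition is vacuous here but still needs some vertex; nonemptiness of `s`
    -- supplies it.
    exact ⟨Finset.map_nonempty.2 ⟨v, hv⟩, fun _ _ _ h => (inrₗ_notMem_map_inlEmbedding h).elim,
      ⟨e, fun _ h => he (inlₗ_mem_map_inlEmbedding.1 h)⟩,
      v, fun _ h => (inrₗ_notMem_map_inlEmbedding h).elim⟩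
  · rintro ⟨hs, -, ⟨e, he⟩, -⟩
    exact ⟨Finset.map_nonempty.1 hs, e, fun v hv => he v (inlₗ_mem_map_inlEmbedding.2 hv)⟩

theorem mem_dual_upperClosure_iff (H : IndexedHypergraph V E) (s : Finset E) :
    s ∈ H.dual.upperClosure.faces ↔
      s.map (inrEmbedding V E).toEmbedding ∈ H.bicliqueComplex.faces := by
  constructor
  · rintro ⟨⟨e, he⟩, v, hv⟩
    exact ⟨Finset.map_nonempty.2 ⟨e, he⟩, fun _ _ h => (inlₗ_notMem_map_inrEmbedding h).elim,
      ⟨e, fun _ h => (inlₗ_notMem_map_inrEmbedding h).elim⟩,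
      v, fun _ h => hv (inrₗ_mem_map_inrEmbedding.1 h)⟩
  · rintro ⟨hs, -, -, v, hv⟩
    exact ⟨Finset.map_nonempty.1 hs, v, fun e he => hv e (inrₗ_mem_map_inrEmbedding.2 he)⟩

theorem inrₗ_mem_outer_iff {s : Finset (V ⊕ₗ E)} {e : E} :
    Sum.inrₗ e ∈ FinsetChain.outer (Set.range (inlEmbedding V E)) s ↔ Sum.inrₗ e ∈ s := by
  refine FinsetChain.mem_outer.trans (and_iff_left ?_)
  rintro ⟨v, hv⟩
  exact Sum.inl_ne_inr (toLex.injective hv)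

theorem inlₗ_mem_outer_iff {s : Finset (V ⊕ₗ E)} {v : V} :
    Sum.inlₗ v ∈ FinsetChain.outer (Set.range (inrEmbedding V E)) s ↔ Sum.inlₗ v ∈ s := by
  refine FinsetChain.mem_outer.trans (and_iff_left ?_)
  rintro ⟨e, he⟩
  exact Sum.inr_ne_inl (toLex.injective he)

/-- The apex is a common vertex of the hyperedges in `σ`, which are all the hyperedges of `s`. -/
theorem hasApex_inlEmbedding (H : IndexedHypergraph V E) :
    FinsetChain.HasApex H.bicliqueComplex (Set.range (inlEmbedding V E)) := by
  rintro σ ⟨⟨x, hx⟩, -, -, v, hv⟩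
  refine ⟨Sum.inlₗ v, ⟨v, rfl⟩, ?_⟩
  rintro s ⟨-, hs, -, -⟩ rfl
  have hv' : ∀ e, Sum.inrₗ e ∈ s → v ∈ H.edge e := fun e he => hv e (inrₗ_mem_outer_iff.2 he)
  have hins : ∀ w e, Sum.inlₗ w ∈ insert (Sum.inlₗ v) s → Sum.inrₗ e ∈ s → w ∈ H.edge e := by
    intro w e hw he
    rcases Finset.mem_insert.1 hw with h | h
    · rw [Sum.inl_injective (toLex.injective h)]; exact hv' e he
    · exact hs w e h he
  have hr : ∀ e, Sum.inrₗ e ∈ insert (Sum.inlₗ v) s → Sum.inrₗ e ∈ s := fun e he =>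
    (Finset.mem_insert.1 he).resolve_left fun h => Sum.inr_ne_inl (toLex.injective h)
  refine ⟨Finset.insert_nonempty _ _, fun w e hw he => hins w e hw (hr e he), ?_, v,
    fun e he => hv' e (hr e he)⟩
  -- The enlarged vertex part still needs a common hyperedge: any hyperedge in the nonempty outer
  -- part works.
  obtain ⟨hxs, hxr⟩ := FinsetChain.mem_outer.1 hx
  rcases mem_range_or_mem_range x with ⟨w, rfl⟩ | ⟨e, rfl⟩
  · exact (hxr ⟨w, rfl⟩).elim
  · exact ⟨e, fun w hw => hins w e hw hxs⟩

theorem hasApex_inrEmbedding (H : IndexedHypergraph V E) :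
    FinsetChain.HasApex H.bicliqueComplex (Set.range (inrEmbedding V E)) := by
  rintro σ ⟨⟨x, hx⟩, -, ⟨e, he⟩, -⟩
  refine ⟨Sum.inrₗ e, ⟨e, rfl⟩, ?_⟩
  rintro s ⟨-, hs, -, -⟩ rfl
  have he' : ∀ v, Sum.inlₗ v ∈ s → v ∈ H.edge e := fun v hv => he v (inlₗ_mem_outer_iff.2 hv)
  have hins : ∀ v d, Sum.inlₗ v ∈ s → Sum.inrₗ d ∈ insert (Sum.inrₗ e) s → v ∈ H.edge d := by
    intro v d hv hd
    rcases Finset.mem_insert.1 hd with h | h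
    · rw [Sum.inr_injective (toLex.injective h)]; exact he' v hv
    · exact hs v d hv h
  have hl : ∀ v, Sum.inlₗ v ∈ insert (Sum.inrₗ e) s → Sum.inlₗ v ∈ s := fun v hv =>
    (Finset.mem_insert.1 hv).resolve_left fun h => Sum.inl_ne_inr (toLex.injective h)
  refine ⟨Finset.insert_nonempty _ _, fun v d hv hd => hins v d (hl v hv) hd,
    ⟨e, fun v hv => he' v (hl v hv)⟩, ?_⟩
  obtain ⟨hxs, hxr⟩ := FinsetChain.mem_outer.1 hx
  rcases mem_range_or_mem_range x with ⟨v, rfl⟩ | ⟨d, rfl⟩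
  · exact ⟨v, fun d hd => hins v d hxs hd⟩
  · exact (hxr ⟨d, rfl⟩).elim

end IndexedHypergraph

theorem mainTheorem3 (R : Type w) [CommRing R] {V : Type u} {E : Type v}
    [LinearOrder V] [LinearOrder E] (H : IndexedHypergraph V E) (p : ℕ) :
    Nonempty (H.ClosureHomology R p ≃ₗ[R] H.dual.ClosureHomology R p) := by
  obtain ⟨φ⟩ := FinsetChain.nonempty_homology_equiv R (IndexedHypergraph.inlEmbedding V E)
    H.mem_upperClosure_iff H.hasApex_inlEmbedding p
  obtain ⟨ψ⟩ := FinsetChain.nonempty_homology_equiv R (IndexedHypergraph.inrEmbedding V E)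
    H.mem_dual_upperClosure_iff H.hasApex_inrEmbedding p
  exact ⟨φ.trans ψ.symm⟩
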